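/- Let $(p(i))_{i\ge 0}$ and $(q(i))_{i\ge 1}$ be real numbers with $p(0)=1$ and, for all $i\ge 1$, $0<p(i)<1$ and $p(i)+q(i)=1$. Consider the $(1,1)$-reflecting random walk on $\{0,1,2,\dots\}$, that is, the Markov chain with transition probabilities $P_{01}=1$ and, for $i\ge 1$, $P_{i,i+1}=p(i)$, $P_{i,i-1}=q(i)$, all other $P_{ij}$ being $0$. Suppose that $p(i)\to p$ as $i\to\infty$, where $p<\frac12$. Then the chain has exactly one stationary distribution $\pi$ (a probability distribution on $\{0,1,2,\dots\}$ with $\pi P=\pi$), it satisfies $\pi(i)>0$ for all $i\ge 0$, and, if $p>0$, $$\lim_{i\to\infty}\frac{\log \pi(i)}{i}=-\log\frac{1-p}{p}.$$ -/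

import Mathlib

open Filter Topology MeasureTheory ProbabilityTheory

noncomputable section

/-- Transition probabilities `P i j` of the nearest-neighbour (that is, `(1,1)`) walk on
`{0, 1, 2, …}`: from `i` the walk moves up to `i + 1` with probability `p i`, and from `i ≥ 1` it
moves down to `i - 1` with probability `q i`. Reflection at `0` is the requirement `p 0 = 1`;
the value `q 0` is never used. -/
def walkTransition (p q : ℕ → ℝ) (i j : ℕ) : ℝ :=
  if j = i + 1 then p i else if i = j + 1 then q i else 0

/-- The kernel on the countable discrete space `ℕ` with transition probabilities `P`:
from `i` it jumps to `j` with probability `P i j`. -/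
def transitionKernel (P : ℕ → ℕ → ℝ) : Kernel ℕ ℕ where
  toFun i := Measure.sum fun j => ENNReal.ofReal (P i j) • Measure.dirac j
  measurable' := measurable_of_countable _

/-- A stationary distribution of the Markov chain with transition probabilities `P` is a
probability measure `π` on `ℕ` that is invariant under the chain, `π P = π`. -/
def IsStationaryDistribution (P : ℕ → ℕ → ℝ) (π : Measure ℕ) : Prop :=
  IsProbabilityMeasure π ∧ (transitionKernel P).Invariant π

end

/-! On a half-line the stationary flow across each edge must vanish, so invariance reduces to
detailed balance (`balance_iff_detailed_balance`). That is a first-order recursion, so its solutions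
are the multiples of `balanceWeight`. The ratios of consecutive weights tend to `pLim / (1 - pLim) <
1`, so the weights are summable, and normalizing them gives existence, uniqueness and positivity.
The decay rate is the limit of the averaged logarithms of these ratios. -/

lemma transitionKernel_apply_singleton (P : ℕ → ℕ → ℝ) (i j : ℕ) :
    transitionKernel P i {j} = ENNReal.ofReal (P i j) := by
  change (Measure.sum fun j => ENNReal.ofReal (P i j) • Measure.dirac j) {j} = _
  rw [Measure.sum_apply _ (measurableSet_singleton j), tsum_eq_single j]
  · simp
  · intro b hb
    simp [hb]

lemma bind_transitionKernel_singleton (P : ℕ → ℕ → ℝ) (π : Measure ℕ) (j : ℕ) :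
    π.bind (transitionKernel P) {j} = ∑' i, ENNReal.ofReal (P i j) * π {i} := by
  rw [Measure.bind_apply (measurableSet_singleton j) (Kernel.aemeasurable _), lintegral_countable']
  simp only [transitionKernel_apply_singleton]

lemma bind_walkTransition_zero (p q : ℕ → ℝ) (π : Measure ℕ) :
    π.bind (transitionKernel (walkTransition p q)) {0} = ENNReal.ofReal (q 1) * π {1} := by
  rw [bind_transitionKernel_singleton, tsum_eq_single 1]
  · simp [walkTransition]
  · intro i hi
    simp [walkTransition, hi]

lemma bind_walkTransition_succ (p q : ℕ → ℝ) (π : Measure ℕ) (j : ℕ) :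
    π.bind (transitionKernel (walkTransition p q)) {j + 1} =
      ENNReal.ofReal (p j) * π {j} + ENNReal.ofReal (q (j + 2)) * π {j + 2} := by
  rw [bind_transitionKernel_singleton, tsum_eq_sum (s := {j, j + 2}), Finset.sum_pair (by omega)]
  · simp [walkTransition]
  · intro i hi
    simp only [Finset.mem_insert, Finset.mem_singleton, not_or] at hi
    have h1 : ¬ j = i := by omega
    have h2 : ¬ i = j + 1 + 1 := by omega
    simp [walkTransition, h1, h2]

/-- Invariance under the walk, written as the balance equations of the point masses. -/
lemma invariant_walkTransition_iff_balance {p q : ℕ → ℝ} (hp : ∀ i, 0 ≤ p i)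
    (hq : ∀ i, 0 ≤ q (i + 1)) (π : Measure ℕ) [IsFiniteMeasure π] :
    (transitionKernel (walkTransition p q)).Invariant π ↔
      q 1 * π.real {1} = π.real {0} ∧
      ∀ j, p j * π.real {j} + q (j + 2) * π.real {j + 2} = π.real {j + 1} := by
  have key : ∀ i, π {i} = ENNReal.ofReal (π.real {i}) := fun i => by simp
  have h0 : ∀ i, 0 ≤ π.real {i} := fun i => measureReal_nonneg
  have e0 : π.bind (transitionKernel (walkTransition p q)) {0} = π {0} ↔
      q 1 * π.real {1} = π.real {0} := by
    rw [bind_walkTransition_zero, key 0, key 1, ← ENNReal.ofReal_mul (hq 0),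
      ENNReal.ofReal_eq_ofReal_iff (mul_nonneg (hq 0) (h0 _)) (h0 _)]
  have e1 : ∀ j, π.bind (transitionKernel (walkTransition p q)) {j + 1} = π {j + 1} ↔
      p j * π.real {j} + q (j + 2) * π.real {j + 2} = π.real {j + 1} := by
    intro j
    have ha := mul_nonneg (hp j) (h0 j)
    have hb := mul_nonneg (hq (j + 1)) (h0 (j + 2))
    rw [bind_walkTransition_succ, key j, key (j + 1), key (j + 2), ← ENNReal.ofReal_mul (hp j),
      ← ENNReal.ofReal_mul (hq (j + 1)), ← ENNReal.ofReal_add ha hb,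
      ENNReal.ofReal_eq_ofReal_iff (add_nonneg ha hb) (h0 _)]
  rw [Kernel.Invariant, Measure.ext_iff_singleton, ← e0]
  constructor
  · exact fun h => ⟨h 0, fun j => (e1 j).1 (h _)⟩
  · rintro ⟨h, h'⟩ (_ | j)
    · exact h
    · exact (e1 j).2 (h' j)

/-- For a walk reflected at `0`, the balance equations are equivalent to detailed balance. -/
lemma balance_iff_detailed_balance {p q w : ℕ → ℝ} (hp0 : p 0 = 1)
    (hpq : ∀ i, 1 ≤ i → q i + p i = 1) :
    (q 1 * w 1 = w 0 ∧ ∀ j, p j * w j + q (j + 2) * w (j + 2) = w (j + 1)) ↔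
      ∀ j, q (j + 1) * w (j + 1) = p j * w j := by
  constructor
  · rintro ⟨h0, h⟩ j
    -- The net flow across the edge `{j, j + 1}` does not depend on `j`, and reflection makes it
    -- zero at the first edge.
    induction j with
    | zero => simpa [hp0] using h0
    | succ j ih =>
      have := hpq (j + 1) (by omega)
      linear_combination h j + ih - w (j + 1) * this
  · intro h
    refine ⟨by simpa [hp0] using h 0, fun j => ?_⟩
    have := hpq (j + 1) (by omega)
    linear_combination h (j + 1) - h j + w (j + 1) * this

/-- The solution of detailed balance normalized to be `1` at `0`. -/
noncomputable def balanceWeight (p q : ℕ → ℝ) (n : ℕ) : ℝ :=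
  ∏ i ∈ Finset.range n, p i / q (i + 1)

lemma balanceWeight_succ (p q : ℕ → ℝ) (n : ℕ) :
    balanceWeight p q (n + 1) = balanceWeight p q n * (p n / q (n + 1)) :=
  Finset.prod_range_succ _ _

lemma balanceWeight_pos {p q : ℕ → ℝ} (hp : ∀ i, 0 < p i) (hq : ∀ i, 0 < q (i + 1)) (n : ℕ) :
    0 < balanceWeight p q n :=
  Finset.prod_pos fun i _ => div_pos (hp i) (hq i)

lemma detailed_balance_iff {p q w : ℕ → ℝ} (hq : ∀ i, 0 < q (i + 1)) :
    (∀ j, q (j + 1) * w (j + 1) = p j * w j) ↔ ∀ n, w n = w 0 * balanceWeight p q n := by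
  constructor
  · intro h n
    induction n with
    | zero => simp [balanceWeight]
    | succ n ih =>
      rw [balanceWeight_succ, ← mul_assoc, ← ih, mul_div_assoc', eq_div_iff (hq n).ne']
      linear_combination h n
  · intro h j
    rw [h (j + 1), h j, balanceWeight_succ]
    field_simp [(hq j).ne']

lemma summable_balanceWeight {p q : ℕ → ℝ} {r : ℝ} (hp : ∀ i, 0 < p i) (hq : ∀ i, 0 < q (i + 1))
    (hr : r < 1) (h : Tendsto (fun n => p n / q (n + 1)) atTop (𝓝 r)) :
    Summable (balanceWeight p q) := by
  have hpos := balanceWeight_pos hp hq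
  refine summable_of_ratio_test_tendsto_lt_one hr (.of_forall fun n => (hpos n).ne') ?_
  refine h.congr fun n => ?_
  rw [balanceWeight_succ, Real.norm_of_nonneg (mul_pos (hpos n) (div_pos (hp n) (hq n))).le,
    Real.norm_of_nonneg (hpos n).le, mul_div_cancel_left₀ _ (hpos n).ne']

lemma tendsto_log_balanceWeight_div {p q : ℕ → ℝ} {r : ℝ} (hp : ∀ i, 0 < p i)
    (hq : ∀ i, 0 < q (i + 1)) (hr : r ≠ 0)
    (h : Tendsto (fun n => p n / q (n + 1)) atTop (𝓝 r)) :
    Tendsto (fun n : ℕ => Real.log (balanceWeight p q n) / n) atTop (𝓝 (Real.log r)) := by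
  -- The logarithm of the product, divided by `n`, is the Cesàro mean of the log-ratios.
  refine (h.log hr).cesaro.congr fun n => ?_
  rw [balanceWeight, Real.log_prod fun i _ => (div_pos (hp i) (hq i)).ne', div_eq_inv_mul]

lemma hasSum_measureReal_singleton (π : Measure ℕ) [IsProbabilityMeasure π] :
    HasSum (fun n => π.real {n}) 1 := by
  have h : ∑' n, π {n} = 1 := by
    have := lintegral_countable' (μ := π) (fun _ : ℕ => (1 : ENNReal))
    simpa using this.symm
  have h2 := ENNReal.hasSum_toReal (f := fun n => π {n}) (by simp [h])
  rwa [← ENNReal.tsum_toReal_eq (fun n => measure_ne_top π _), h, ENNReal.toReal_one] at h2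

lemma exists_isProbabilityMeasure_of_hasSum {w : ℕ → ℝ} (h0 : ∀ n, 0 ≤ w n) (h : HasSum w 1) :
    ∃ π : Measure ℕ, IsProbabilityMeasure π ∧ ∀ n, π.real {n} = w n := by
  have hs : HasSum (fun n => ENNReal.ofReal (w n)) 1 := by
    rw [ENNReal.summable.hasSum_iff, ← ENNReal.ofReal_tsum_of_nonneg h0 h.summable, h.tsum_eq,
      ENNReal.ofReal_one]
  let f : PMF ℕ := ⟨fun n => ENNReal.ofReal (w n), hs⟩
  refine ⟨f.toMeasure, inferInstance, fun n => ?_⟩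
  rw [Measure.real, PMF.toMeasure_apply_singleton _ _ (measurableSet_singleton n)]
  exact ENNReal.toReal_ofReal (h0 n)

/-- A probability measure is stationary for a walk reflected at `0` iff its point masses are
the normalized balance weights. -/
lemma isStationaryDistribution_walkTransition_iff {p q : ℕ → ℝ} (hp0 : p 0 = 1)
    (hp : ∀ i, 0 < p i) (hq : ∀ i, 0 < q (i + 1)) (hpq : ∀ i, 1 ≤ i → q i + p i = 1)
    (π : Measure ℕ) :
    IsStationaryDistribution (walkTransition p q) π ↔ IsProbabilityMeasure π ∧
      ∀ n, π.real {n} = (∑' k, balanceWeight p q k)⁻¹ * balanceWeight p q n := by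
  refine and_congr_right fun _ => ?_
  rw [invariant_walkTransition_iff_balance (fun i => (hp i).le) (fun i => (hq i).le),
    balance_iff_detailed_balance (w := fun n => π.real {n}) hp0 hpq,
    detailed_balance_iff (w := fun n => π.real {n}) hq]
  constructor
  · intro h n
    -- Total mass one determines the mass at `0`. Divergent weights are excluded too: their `tsum`
    -- would be `0`, and no multiple of it is `1`.
    have hsum := (hasSum_measureReal_singleton π).tsum_eq
    rw [tsum_congr h] at hsum
    rw [tsum_mul_left] at hsum
    rw [h n, eq_inv_of_mul_eq_one_left hsum]
  · intro h n
    rw [h n, h 0]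
    simp [balanceWeight]

theorem corollaryc3p3 (p q : ℕ → ℝ) (pLim : ℝ)
    (hp0 : p 0 = 1)
    (hp : ∀ i, 1 ≤ i → 0 < p i ∧ p i < 1)
    (hpq : ∀ i, 1 ≤ i → q i + p i = 1)
    (hlim : Tendsto p atTop (𝓝 pLim))
    (hhalf : pLim < 1 / 2) :
    (∃! π : Measure ℕ, IsStationaryDistribution (walkTransition p q) π) ∧
    ∀ π : Measure ℕ, IsStationaryDistribution (walkTransition p q) π →
      (∀ i : ℕ, 0 < π.real {i}) ∧
      (0 < pLim →
        Tendsto (fun i : ℕ => Real.log (π.real {i}) / (i : ℝ)) atTop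
          (𝓝 (-Real.log ((1 - pLim) / pLim)))) := by
  have hp' : ∀ i, 0 < p i := by
    rintro (_ | i)
    · simp [hp0]
    · exact (hp _ (by omega)).1
  have hq : ∀ i, 0 < q (i + 1) := fun i => by
    linarith [hpq (i + 1) (by omega), (hp (i + 1) (by omega)).2]
  have hr : Tendsto (fun n => p n / q (n + 1)) atTop (𝓝 (pLim / (1 - pLim))) := by
    refine hlim.div ?_ (by linarith)
    refine (((tendsto_add_atTop_iff_nat 1).2 hlim).const_sub 1).congr fun n => ?_
    linarith [hpq (n + 1) (by omega)]
  have hr1 : pLim / (1 - pLim) < 1 := by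
    rw [div_lt_one (by linarith)]
    linarith
  have hs := summable_balanceWeight hp' hq hr1 hr
  have hpos := balanceWeight_pos hp' hq
  have hS : 0 < ∑' k, balanceWeight p q k := hs.tsum_pos (fun n => (hpos n).le) 0 (hpos 0)
  have hiff := isStationaryDistribution_walkTransition_iff hp0 hp' hq hpq
  refine ⟨?_, fun π hπ => ?_⟩
  · obtain ⟨π, hπ, hw⟩ := exists_isProbabilityMeasure_of_hasSum
      (w := fun n => (∑' k, balanceWeight p q k)⁻¹ * balanceWeight p q n)
      (fun n => (mul_pos (inv_pos.2 hS) (hpos n)).le)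
      (by simpa [hS.ne'] using hs.hasSum.mul_left (∑' k, balanceWeight p q k)⁻¹)
    refine ⟨π, (hiff π).2 ⟨hπ, hw⟩, fun ν hν => ?_⟩
    obtain ⟨_, hw'⟩ := (hiff ν).1 hν
    refine Measure.ext_of_singleton fun n => ?_
    rw [← measureReal_eq_measureReal_iff, hw', hw]
  · obtain ⟨_, hw⟩ := (hiff π).1 hπ
    refine ⟨fun i => by rw [hw]; exact mul_pos (inv_pos.2 hS) (hpos i), fun hp1 => ?_⟩
    have hr0 : pLim / (1 - pLim) ≠ 0 := (div_pos hp1 (by linarith)).ne'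
    -- The normalizing constant adds a fixed term to the logarithm, which vanishes after division by
    -- `n`.
    have h1 := (tendsto_const_div_atTop_nhds_zero_nat
      (Real.log (∑' k, balanceWeight p q k)⁻¹)).add (tendsto_log_balanceWeight_div hp' hq hr0 hr)
    rw [zero_add, ← inv_div (1 - pLim) pLim, Real.log_inv ((1 - pLim) / pLim)] at h1
    refine h1.congr fun n => ?_
    rw [hw, Real.log_mul (inv_pos.2 hS).ne' (hpos n).ne', add_div]
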